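/- A \emph{type} of degree $d$ (written $\tau\vDash d$) is a finite multiset $\tau=\{(b_1,m_1),\dots,(b_r,m_r)\}$ of ordered pairs of positive integers with $\sum_i b_im_i=d$; write it as $\tau=(b_1^{m_1}\cdots b_r^{m_r})$, and let $\tau[b^m]$ be the number of occurrences of $(b,m)$ in $\tau$. Let $x_{ij}$ $(i,j\ge 1)$ be indeterminates, with $x_{ij}$ of degree $i$. Let $H_b$ be the sum of all monomials of degree $b$ in the $x_{ij}$, and for a type $\lambda$ put $H_\lambda=\prod_{b^m\in\lambda}\psi_m(H_b)$ (product with multiplicity), where $\psi_m$ is the substitution $x_{ij}\mapsto x_{ij}^m$. A monomial $x_{i_1j_1}^{m_1}\cdots x_{i_rj_r}^{m_r}$ in distinct indeterminates with all $m_k\ge1$ has type $(i_1^{m_1}\cdots i_r^{m_r})$, and $M_\tau$ is the sum of all monomials of type $\tau$. For $\lambda\vDash d$ there are unique integers $a_{\tau\lambda}$, the \emph{arrangement numbers}, with $$H_\lambda=\sum_{\tau\vDash d}a_{\tau\lambda}M_\tau .$$ \textbf{Theorem.} Let $d\ge 1$. The matrix $a=(a_{\tau\lambda})_{\tau,\lambda\vDash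 d}$ is invertible over $\mathbb{Q}$. Let $a^{-1}_{\tau d}$ be the entry of $a^{-1}$ in row $\tau$ and in the column of the type $d=(d^1)$. Then for every type $\tau$ of degree $d$: \begin{enumerate} \item if $\tau$ is mixed, i.e. its parts do not all have the same multiplicity, then $a^{-1}_{\tau d}=0$; \item if all parts of $\tau=(b_1^m\cdots b_r^m)$ have the same multiplicity $m$, then $$a^{-1}_{\tau d}=\frac{\mu(m)}{m}\cdot\frac{(-1)^{r-1}}{r}\cdot\frac{r!}{\tau[1^m]!\cdots\tau[(d/m)^m]!},$$ where $\mu$ is the M\"obius function. \end{enumerate} -/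

import Mathlib

noncomputable section

namespace Polysymmetric

/-- The index set of the indeterminates `x_{ij}` (`i, j ≥ 1`); `x_{ij}` has degree `i`. -/
abbrev Var : Type := ℕ+ × ℕ+

/-- A monomial in the indeterminates `x_{ij}`, given by its exponents. -/
abbrev Mon : Type := Var →₀ ℕ

/-- The degree of a monomial, where `x_{ij}` has degree `i`. -/
def degree (e : Mon) : ℕ := e.sum fun v k => k * (v.1 : ℕ)

/-- The type `(i_1^{m_1} ⋯ i_r^{m_r})` of the monomial `x_{i_1j_1}^{m_1} ⋯ x_{i_rj_r}^{m_r}`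
(distinct indeterminates, positive exponents). -/
def monType (e : Mon) : Multiset (ℕ × ℕ) := e.support.val.map fun v => ((v.1 : ℕ), e v)

/-- Types of degree `d`: finite multisets of pairs `(b, m)` of positive integers, written `b^m`,
with `∑ b * m = d`. -/
abbrev PolyType (d : ℕ) : Type :=
  {τ : Multiset (ℕ × ℕ) // (∀ p ∈ τ, 0 < p.1 ∧ 0 < p.2) ∧ (τ.map fun p => p.1 * p.2).sum = d}

instance instFinitePolyType (d : ℕ) : Finite (PolyType d) := by
  classical
  refine Set.Finite.subset
    (Set.finite_Icc (0 : Multiset (ℕ × ℕ)) (d • (Finset.Icc 1 d ×ˢ Finset.Icc 1 d).val)) ?_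
  rintro τ ⟨hpos, hsum⟩
  refine ⟨zero_le, Multiset.le_iff_count.2 fun p => ?_⟩
  by_cases hp : p ∈ τ
  · have hle : p.1 * p.2 ≤ d := by
      rw [← hsum]
      exact Multiset.single_le_sum (fun _ _ => Nat.zero_le _) _ (Multiset.mem_map_of_mem _ hp)
    have h12 := hpos p hp
    have h1 : p.1 ≤ d := le_trans (Nat.le_mul_of_pos_right _ h12.2) hle
    have h2 : p.2 ≤ d := le_trans (Nat.le_mul_of_pos_left _ h12.1) hle
    have hmem : p ∈ (Finset.Icc 1 d ×ˢ Finset.Icc 1 d) := by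
      simp only [Finset.mem_product, Finset.mem_Icc]; omega
    have hcard : τ.card ≤ d := by
      have : (τ.map fun p => p.1 * p.2).card • 1 ≤ (τ.map fun p => p.1 * p.2).sum := by
        refine Multiset.card_nsmul_le_sum fun x hx => ?_
        obtain ⟨q, hq, rfl⟩ := Multiset.mem_map.1 hx
        exact Nat.mul_pos (hpos q hq).1 (hpos q hq).2
      simpa [hsum] using this
    have hc1 : (Finset.Icc 1 d ×ˢ Finset.Icc 1 d).val.count p = 1 :=
      Multiset.count_eq_one_of_mem (Finset.nodup _) hmem
    rw [Multiset.count_nsmul, hc1]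
    exact le_trans (Multiset.count_le_card _ _) (by simpa using hcard)
  · rw [Multiset.count_eq_zero_of_notMem hp]; exact Nat.zero_le _

instance instFintypePolyType (d : ℕ) : Fintype (PolyType d) := Fintype.ofFinite _

/-- The type `d = (d^1)`, the top stratum in degree `d ≥ 1`. -/
def topType (d : ℕ) (hd : 0 < d) : PolyType d := ⟨{(d, 1)}, by simp [hd], by simp⟩

/-- The `d`-th complete homogeneous polysymmetric function `H_d`,
the sum of all monomials of degree `d`. -/
def completeHom (d : ℕ) : MvPowerSeries Var ℤ := fun e => if degree e = d then 1 else 0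

/-- The Adams operation `ψ_m` on power series in the `x_{ij}`, i.e. the substitution
`x_{ij} ↦ x_{ij}^m` (used for `m ≥ 1`). -/
def adams (m : ℕ) (F : MvPowerSeries Var ℤ) : MvPowerSeries Var ℤ :=
  MvPowerSeries.subst (fun v => (MvPowerSeries.X v : MvPowerSeries Var ℤ) ^ m) F

/-- `H_λ = ∏_{b^m ∈ λ} ψ_m (H_b)` (product with multiplicity). -/
def completeHomType (l : Multiset (ℕ × ℕ)) : MvPowerSeries Var ℤ :=
  (l.map fun p => adams p.2 (completeHom p.1)).prod

/-- The monomial polysymmetric function `M_τ`, the sum of all monomials of type `τ`. -/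
def monomialSymm (τ : Multiset (ℕ × ℕ)) : MvPowerSeries Var ℤ :=
  fun e => if monType e = τ then 1 else 0

/-- An arrangement of `b^m = (b_i^{m_i})_i` into `c^n = (c_j^{n_j})_j`: a matrix of nonnegative
integers `A` with `A n = m` and `Aᵀ b = c`. -/
def ArrangementVec {ι κ : Type} [Fintype ι] [Fintype κ] (b m : ι → ℕ) (c n : κ → ℕ) : Type :=
  {A : Matrix ι κ ℕ // A.mulVec n = m ∧ A.transpose.mulVec b = c}

/-- An arrangement of the type `τ` into the type `l`, with rows indexed by the parts of `τ` and
columns indexed by the parts of `l` (each part as often as it occurs). -/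
def Arrangement (τ l : Multiset (ℕ × ℕ)) : Type :=
  ArrangementVec (fun i : τ => (i : ℕ × ℕ).1) (fun i : τ => (i : ℕ × ℕ).2)
    (fun j : l => (j : ℕ × ℕ).1) (fun j : l => (j : ℕ × ℕ).2)

/-! Expansion of `H_λ` in the family `M_τ`. -/

theorem coeff_adams_completeHom (m b : ℕ) (hm : 0 < m) (e : Mon) :
    MvPowerSeries.coeff e (adams m (completeHom b)) =
      open Classical in if ∃ g : Mon, m • g = e ∧ degree g = b then 1 else 0 := by
  classical
  have hexp : adams m (completeHom b) = MvPowerSeries.expand m hm.ne' (completeHom b) := by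
    rw [MvPowerSeries.expand, MvPowerSeries.substAlgHom_apply]; rfl
  rw [hexp]
  by_cases h : ∃ g : Mon, m • g = e
  · obtain ⟨g, rfl⟩ := h
    rw [MvPowerSeries.coeff_expand_smul]
    have : (∃ g' : Mon, m • g' = m • g ∧ degree g' = b) ↔ degree g = b := by
      constructor
      · rintro ⟨g', h1, h2⟩
        have : g' = g := by
          ext v
          have := DFunLike.congr_fun h1 v
          simp only [Finsupp.smul_apply, smul_eq_mul] at this
          exact Nat.eq_of_mul_eq_mul_left hm this
        rw [← this]; exact h2
      · intro h; exact ⟨g, rfl, h⟩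
    simp only [this]
    rfl
  · rw [if_neg (fun ⟨g, hg, _⟩ => h ⟨g, hg⟩)]
    have : ∃ v, ¬ m ∣ e v := by
      by_contra! hc
      refine h ⟨e.mapRange (fun n => n / m) (Nat.zero_div m), ?_⟩
      ext v
      simp [Nat.mul_div_cancel' (hc v)]
    obtain ⟨v, hv⟩ := this
    exact MvPowerSeries.coeff_expand_of_not_dvd m hm.ne' _ hv

/-- Families of monomials `(f_j)` with `∏ f_j ^ n_j` the given monomial and `deg f_j = c_j`. -/
def Factorization (e : Mon) (l : Multiset (ℕ × ℕ)) : Type :=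
  {g : l → Mon // ∑ j : l, (j : ℕ × ℕ).2 • g j = e ∧ ∀ j : l, degree (g j) = (j : ℕ × ℕ).1}

theorem coeff_completeHomType (l : Multiset (ℕ × ℕ)) (hl : ∀ p ∈ l, 0 < p.2) (e : Mon) :
    MvPowerSeries.coeff e (completeHomType l) = (Nat.card (Factorization e l) : ℤ) := by
  classical
  have h1 : completeHomType l =
      ∏ j : l, adams (j : ℕ × ℕ).2 (completeHom (j : ℕ × ℕ).1) := by
    rw [completeHomType, ← Multiset.map_univ]; rfl
  have hl' : ∀ j : l, 0 < (j : ℕ × ℕ).2 := fun j => hl _ (Multiset.coe_mem)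
  rw [h1, MvPowerSeries.coeff_prod]
  simp only [coeff_adams_completeHom _ _ (hl' _)]
  simp only [Finset.prod_ite_zero, Finset.prod_const_one, Finset.sum_boole, Finset.mem_univ,
    true_imp_iff]
  norm_cast
  rw [← Nat.card_eq_finsetCard]
  refine (Nat.card_congr (Equiv.ofBijective
    (fun g : Factorization e l => (⟨Finsupp.equivFunOnFinite.symm
      (fun j : l => (j : ℕ × ℕ).2 • g.1 j), ?_⟩ : {x // x ∈ _})) ⟨?_, ?_⟩)).symm
  · rw [Finset.mem_filter, Finset.mem_finsuppAntidiag]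
    exact ⟨⟨g.2.1, Finset.subset_univ _⟩, fun j => ⟨g.1 j, rfl, g.2.2 j⟩⟩
  · intro g g' h
    refine Subtype.ext (funext fun j => Finsupp.ext fun v => ?_)
    have := DFunLike.congr_fun (DFunLike.congr_fun (Subtype.ext_iff.1 h) j) v
    exact Nat.eq_of_mul_eq_mul_left (hl' j) this
  · rintro ⟨x, hx⟩
    rw [Finset.mem_filter, Finset.mem_finsuppAntidiag] at hx
    choose g hg hd using hx.2
    refine ⟨⟨g, ?_, hd⟩, Subtype.ext (Finsupp.ext fun j => hg j)⟩
    simp only [hg]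
    exact hx.1.1

theorem exists_equiv_of_map_eq {ι ι' α : Type} [Fintype ι] [Fintype ι'] (f : ι → α) (f' : ι' → α)
    (h : Finset.univ.val.map f = Finset.univ.val.map f') : ∃ φ : ι ≃ ι', ∀ i, f' (φ i) = f i := by
  classical
  have hc : ∀ a, Nonempty ({i // f i = a} ≃ {i // f' i = a}) := by
    intro a
    have := congrArg (Multiset.count a) h
    rw [Multiset.count_map, Multiset.count_map] at this
    refine ⟨Fintype.equivOfCardEq ?_⟩
    rw [Fintype.card_subtype, Fintype.card_subtype]
    simpa [Finset.card, eq_comm] using this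
  exact ⟨Equiv.ofFiberEquiv fun a => (hc a).some, fun i => Equiv.ofFiberEquiv_map _ i⟩

/-- Factorizations of a monomial correspond to arrangements of its type. -/
theorem card_factorization (e : Mon) (l : Multiset (ℕ × ℕ)) (hl : ∀ p ∈ l, 0 < p.2) :
    Nat.card (Factorization e l) = Nat.card (Arrangement (monType e) l) := by
  classical
  obtain ⟨φ, hφ⟩ := exists_equiv_of_map_eq (fun v : e.support => (((v : Var).1 : ℕ), e v))
    (fun i : monType e => (i : ℕ × ℕ)) (by
      rw [Multiset.map_univ_coe, monType]
      exact (Multiset.attach_map_val' e.support.val (fun v : Var => ((v.1 : ℕ), e v))))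
  have hl' : ∀ j : l, 0 < (j : ℕ × ℕ).2 := fun j => hl _ (Multiset.coe_mem)
  have hsupp : ∀ g : Factorization e l, ∀ j v, v ∉ e.support → g.1 j v = 0 := by
    intro g j v hv
    have h1 : ∑ j : l, (j : ℕ × ℕ).2 * g.1 j v = 0 := by
      have := DFunLike.congr_fun g.2.1 v
      rw [Finsupp.notMem_support_iff.1 hv] at this
      simpa [Finsupp.finsetSum_apply] using this
    have h2 := (Finset.sum_eq_zero_iff.1 h1) j (Finset.mem_univ j)
    exact (Nat.mul_eq_zero.1 h2).resolve_left (hl' j).ne'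
  have hdeg : ∀ g : Mon, (∀ v, v ∉ e.support → g v = 0) →
      degree g = ∑ v : e.support, g v * ((v : Var).1 : ℕ) := by
    intro g hg
    rw [degree, Finsupp.sum_of_support_subset (s := e.support) _ _ _ (by simp)]
    · exact (Finset.sum_coe_sort e.support fun v : Var => g v * (v.1 : ℕ)).symm
    · intro v hv
      by_contra hc
      exact (Finsupp.mem_support_iff.1 hv) (hg v hc)
  refine Nat.card_congr (Equiv.ofBijective (fun g : Factorization e l =>
    (⟨Matrix.of fun i j => g.1 j (φ.symm i), ?_, ?_⟩ : Arrangement (monType e) l)) ⟨?_, ?_⟩)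
  · funext i
    obtain ⟨v, rfl⟩ := φ.surjective i
    have := DFunLike.congr_fun g.2.1 (v : Var)
    rw [hφ]
    simpa [Matrix.mulVec, dotProduct, Finsupp.finsetSum_apply, mul_comm] using this
  · funext j
    rw [← g.2.2 j, hdeg _ (hsupp g j), ← Equiv.sum_comp φ.symm]
    simp only [Matrix.mulVec, dotProduct, Matrix.transpose_apply, Matrix.of_apply]
    refine Finset.sum_congr rfl fun i _ => ?_
    have := hφ (φ.symm i)
    rw [φ.apply_symm_apply] at this
    rw [this]
  · intro g g' h
    refine Subtype.ext (funext fun j => Finsupp.ext fun v => ?_)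
    by_cases hv : v ∈ e.support
    · have := congrFun (congrFun (Subtype.ext_iff.1 h) (φ ⟨v, hv⟩)) j
      simpa using this
    · rw [hsupp g j v hv, hsupp g' j v hv]
  · rintro ⟨A, h1, h2⟩
    let g : l → Mon := fun j => Finsupp.onFinset e.support
      (fun v => if hv : v ∈ e.support then A (φ ⟨v, hv⟩) j else 0)
      (fun v hv => by by_contra hc; exact hv (dif_neg hc))
    have hg : ∀ j (v : e.support), g j v = A (φ v) j := by
      intro j v
      show (if hv : (v : Var) ∈ e.support then A (φ ⟨v, hv⟩) j else 0) = _
      rw [dif_pos v.2]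
    have hg0 : ∀ j v, v ∉ e.support → g j v = 0 := fun j v hv => dif_neg hv
    refine ⟨⟨g, ?_, fun j => ?_⟩, Subtype.ext (Matrix.ext fun i j => ?_)⟩
    · ext v
      by_cases hv : v ∈ e.support
      · have h3 := congrFun h1 (φ ⟨v, hv⟩)
        rw [hφ] at h3
        have h4 : ∀ j, g j v = A (φ ⟨v, hv⟩) j := fun j => hg j ⟨v, hv⟩
        simpa [Matrix.mulVec, dotProduct, Finsupp.finsetSum_apply, mul_comm, h4] using h3
      · rw [Finsupp.notMem_support_iff.1 hv]
        simp [Finsupp.finsetSum_apply, hg0 _ v hv]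
    · rw [hdeg _ (hg0 j), ← congrFun h2 j, ← Equiv.sum_comp φ.symm]
      simp only [Matrix.mulVec, dotProduct, Matrix.transpose_apply]
      refine Finset.sum_congr rfl fun i _ => ?_
      have := hφ (φ.symm i)
      rw [φ.apply_symm_apply] at this
      rw [this, hg, φ.apply_symm_apply]
    · show g j (φ.symm i) = A i j
      rw [hg, φ.apply_symm_apply]

theorem degree_eq_sum_monType (e : Mon) :
    degree e = ((monType e).map fun p => p.1 * p.2).sum := by
  rw [degree, monType, Multiset.map_map, Finsupp.sum]
  refine Finset.sum_congr rfl fun v _ => ?_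
  exact mul_comm _ _

theorem monType_pos (e : Mon) : ∀ p ∈ monType e, 0 < p.1 ∧ 0 < p.2 := by
  intro p hp
  obtain ⟨v, hv, rfl⟩ := Multiset.mem_map.1 hp
  exact ⟨v.1.pos, Nat.pos_of_ne_zero (Finsupp.mem_support_iff.1 hv)⟩

theorem exists_monType {d : ℕ} (τ : PolyType d) : ∃ e : Mon, monType e = τ.1 := by
  classical
  have hpos : ∀ i : τ.1, 0 < (i : ℕ × ℕ).1 ∧ 0 < (i : ℕ × ℕ).2 :=
    fun i => τ.2.1 _ Multiset.coe_mem
  let k := Fintype.equivFin τ.1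
  let x : τ.1 ↪ Var :=
    ⟨fun i => (⟨(i : ℕ × ℕ).1, (hpos i).1⟩, ⟨(k i : ℕ) + 1, Nat.succ_pos _⟩), by
      intro i i' h
      have h2 := congrArg (fun v : Var => (v.2 : ℕ)) h
      simp only [PNat.mk_coe, add_left_inj] at h2
      exact k.injective (Fin.ext h2)⟩
  let w : τ.1 →₀ ℕ := Finsupp.equivFunOnFinite.symm fun i => (i : ℕ × ℕ).2
  refine ⟨w.embDomain x, ?_⟩
  have hs : w.support = Finset.univ := by
    ext i; simpa [w] using (hpos i).2.ne'
  rw [monType, Finsupp.support_embDomain, hs, Finset.map_val, Multiset.map_map]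
  conv_rhs => rw [← Multiset.map_univ_coe τ.1]
  refine Multiset.map_congr rfl fun i _ => ?_
  simp only [Function.comp_apply, Finsupp.embDomain_apply_self]
  rfl

theorem degree_of_factorization {d : ℕ} (e : Mon) (l : PolyType d) (g : Factorization e l.1) :
    degree e = d := by
  classical
  have hdeg : ∀ e : Mon, degree e = Finsupp.liftAddHom (M := ℕ) (N := ℕ)
      (fun v : Var => AddMonoidHom.mulRight ((v.1 : ℕ))) e := fun e => rfl
  have h := congrArg degree g.2.1
  rw [hdeg, map_sum] at h
  rw [← h]
  refine Eq.trans ?_ l.2.2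
  rw [← Multiset.map_univ l.1 fun p => p.1 * p.2]
  refine Finset.sum_congr rfl fun j _ => ?_
  rw [map_nsmul, ← hdeg, g.2.2, smul_eq_mul, mul_comm]

theorem completeHomType_eq_sum_card {d : ℕ} (l : PolyType d) :
    completeHomType l.1 =
      ∑ τ : PolyType d, (Nat.card (Arrangement τ.1 l.1) : ℤ) • monomialSymm τ.1 := by
  classical
  have hl : ∀ p ∈ l.1, 0 < p.2 := fun p hp => (l.2.1 p hp).2
  have hM : ∀ (τ : Multiset (ℕ × ℕ)) (e : Mon), MvPowerSeries.coeff e (monomialSymm τ) =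
      if monType e = τ then (1 : ℤ) else 0 := fun τ e => rfl
  ext e
  rw [coeff_completeHomType _ hl, map_sum]
  simp only [map_zsmul, hM]
  by_cases he : degree e = d
  · rw [Finset.sum_eq_single
      (⟨monType e, monType_pos e, by rw [← degree_eq_sum_monType, he]⟩ : PolyType d)]
    · simp [card_factorization e _ hl]
    · intro τ _ hτ
      rw [if_neg fun h => hτ (Subtype.ext h.symm), smul_zero]
    · intro h; exact absurd (Finset.mem_univ _) h
  · rw [Finset.sum_eq_zero]
    · have : IsEmpty (Factorization e l.1) := ⟨fun g => he (degree_of_factorization e l g)⟩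
      simp
    · intro τ _
      rw [if_neg, smul_zero]
      intro h
      exact he (by rw [degree_eq_sum_monType, h, τ.2.2])

/-- For `λ` of degree `d` there are unique integers `a(τ, λ)` with
`H_λ = ∑_τ a(τ, λ) M_τ`, the sum over all types `τ` of degree `d`. -/
theorem existsUnique_expansion {d : ℕ} (l : PolyType d) :
    ∃! a : PolyType d → ℤ, completeHomType l.1 = ∑ τ : PolyType d, a τ • monomialSymm τ.1 := by
  classical
  have hM : ∀ (τ : Multiset (ℕ × ℕ)) (e : Mon), MvPowerSeries.coeff e (monomialSymm τ) =
      if monType e = τ then (1 : ℤ) else 0 := fun τ e => rfl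
  have key : ∀ (a : PolyType d → ℤ) (σ : PolyType d) (e : Mon), monType e = σ.1 →
      MvPowerSeries.coeff e (∑ τ : PolyType d, a τ • monomialSymm τ.1) = a σ := by
    intro a σ e he
    rw [map_sum, Finset.sum_eq_single σ]
    · rw [map_zsmul, hM, if_pos he, smul_eq_mul, mul_one]
    · intro τ _ hτ
      rw [map_zsmul, hM, if_neg fun h => hτ (Subtype.ext (h.symm.trans he)), smul_zero]
    · intro h; exact absurd (Finset.mem_univ _) h
  refine ⟨_, completeHomType_eq_sum_card l, fun a ha => funext fun σ => ?_⟩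
  obtain ⟨e, he⟩ := exists_monType σ
  rw [← key a σ e he, ← ha, completeHomType_eq_sum_card l, key _ σ e he]

/-- The arrangement number `a(τ, λ)`: the coefficient of `M_τ` in `H_λ`. -/
def arrangementNumber {d : ℕ} (τ l : PolyType d) : ℤ := (existsUnique_expansion l).choose τ

theorem completeHomType_eq_sum {d : ℕ} (l : PolyType d) :
    completeHomType l.1 = ∑ τ : PolyType d, arrangementNumber τ l • monomialSymm τ.1 :=
  (existsUnique_expansion l).choose_spec.1

/-- `a(τ, λ)` is the number of arrangements of `τ` into `λ`. -/
theorem arrangementNumber_eq_card {d : ℕ} (τ l : PolyType d) :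
    arrangementNumber τ l = (Nat.card (Arrangement τ.1 l.1) : ℤ) :=
  (congrFun ((existsUnique_expansion l).choose_spec.2 _ (completeHomType_eq_sum_card l)) τ).symm

/-- The matrix `(a(τ, λ))`, over `ℚ`, with rows `τ` and columns `λ` running over the types of
degree `d`. -/
def arrangementMatrix (d : ℕ) : Matrix (PolyType d) (PolyType d) ℚ :=
  Matrix.of fun τ l => (arrangementNumber τ l : ℚ)

/-- `τ` is `m`-pure: every part of `τ` has multiplicity `m`. -/
def IsPure (m : ℕ) (τ : Multiset (ℕ × ℕ)) : Prop := ∀ p ∈ τ, p.2 = m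

/-- `τ` is mixed: it is not `m`-pure for any `m ≥ 1`. -/
def IsMixed (τ : Multiset (ℕ × ℕ)) : Prop := ∀ m : ℕ, 0 < m → ¬ IsPure m τ

end Polysymmetric

end

/-! ### The logarithm of the generating series of the `H_b`. -/

noncomputable section

namespace Polysymmetric

open MvPowerSeries

/-! The required column holds the coefficients that write `M_{(d)}`, the sum of the variables of
degree `d`, in terms of the `H_τ`. Since `1 + ∑ H_b = ∏ 1/(1 - x_v)`, its logarithm is `L = ∑_v ∑_k
x_v^k / k`, and Möbius inversion gives `∑_m μ(m)/m ψ_m(L) = ∑_v x_v`. Expanding `L = log(1 + ∑ H_b)`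
by the multinomial theorem and applying `ψ_m` produces exactly the `m`-pure `H_τ`, with coefficient
`μ(m)/m` times `logWeight`; mixed types never occur. The degree `d` part is `mulVec_topColumn`.

The logarithm needs no convergence: both series are truncated at `d`, and
`coeff_truncLog_completeHomSum` compares `truncLog` with `L` through the Euler derivation, which is
injective in positive degrees.

Invertibility is triangularity: `Arrangement.eq_or_sqMult_lt` shows that an arrangement of `τ` into
`λ ≠ τ` strictly lowers the sum of squared multiplicities, and the diagonal is nonzero because of
the identity arrangement. -/

theorem degree_eq_liftAddHom (e : Mon) : degree e = Finsupp.liftAddHom (M := ℕ) (N := ℕ)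
    (fun v : Var => AddMonoidHom.mulRight ((v.1 : ℕ))) e := rfl

@[simp] theorem degree_zero : degree 0 = 0 := by simp [degree]

theorem degree_add (e f : Mon) : degree (e + f) = degree e + degree f := by
  simp only [degree_eq_liftAddHom, map_add]

theorem degree_nsmul (m : ℕ) (e : Mon) : degree (m • e) = m * degree e := by
  simp only [degree_eq_liftAddHom, map_nsmul, smul_eq_mul]

theorem degree_single (v : Var) (k : ℕ) : degree (Finsupp.single v k) = k * (v.1 : ℕ) := by
  simp [degree]

theorem degree_eq_zero_iff (e : Mon) : degree e = 0 ↔ e = 0 := by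
  refine ⟨fun h => ?_, fun h => by simp [h]⟩
  ext v
  by_contra hv
  have := (Finset.sum_eq_zero_iff.1 h) v (Finsupp.mem_support_iff.2 hv)
  exact hv ((Nat.mul_eq_zero.1 this).resolve_right v.1.pos.ne')

/-- The ideal of the series all of whose monomials have degree at least `n`. -/
def highDegree (n : ℕ) : Ideal (MvPowerSeries Var ℚ) where
  carrier := {F | ∀ e, degree e < n → coeff e F = 0}
  add_mem' hF hG e he := by rw [map_add, hF e he, hG e he, add_zero]
  zero_mem' e _ := by simp
  smul_mem' F G hG e he := by
    classical
    rw [smul_eq_mul, coeff_mul]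
    refine Finset.sum_eq_zero fun p hp => ?_
    rw [← Finset.HasAntidiagonal.mem_antidiagonal.1 hp, degree_add] at he
    rw [hG p.2 (by omega), mul_zero]

theorem mem_highDegree {n : ℕ} {F : MvPowerSeries Var ℚ} :
    F ∈ highDegree n ↔ ∀ e, degree e < n → coeff e F = 0 := Iff.rfl

theorem mul_mem_highDegree {a b : ℕ} {F G : MvPowerSeries Var ℚ} (hF : F ∈ highDegree a)
    (hG : G ∈ highDegree b) : F * G ∈ highDegree (a + b) := by
  classical
  intro e he
  rw [coeff_mul]
  refine Finset.sum_eq_zero fun p hp => ?_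
  rw [← Finset.HasAntidiagonal.mem_antidiagonal.1 hp, degree_add] at he
  rcases lt_or_ge (degree p.1) a with h | h
  · rw [hF _ h, zero_mul]
  · rw [hG _ (by omega), mul_zero]

theorem pow_mem_highDegree {G : MvPowerSeries Var ℚ} (hG : G ∈ highDegree 1) (r : ℕ) :
    G ^ r ∈ highDegree r := by
  induction r with
  | zero => exact fun e he => absurd he (Nat.not_lt_zero _)
  | succ r ih => rw [pow_succ]; exact mul_mem_highDegree ih hG

/-- The Euler derivation, multiplying each monomial by its degree. -/
def euler : Derivation ℚ (MvPowerSeries Var ℚ) (MvPowerSeries Var ℚ) :=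
  Derivation.mk'
    { toFun := fun F e => (degree e : ℚ) * coeff e F
      map_add' := fun F G => by
        funext e
        change (degree e : ℚ) * coeff e (F + G) = degree e * coeff e F + degree e * coeff e G
        rw [map_add, mul_add]
      map_smul' := fun c F => by
        funext e
        change (degree e : ℚ) * coeff e (c • F) = c * (degree e * coeff e F)
        rw [coeff_smul]; ring }
    (by
      classical
      intro F G
      ext e
      change (degree e : ℚ) * coeff e (F * G) = _
      rw [map_add, smul_eq_mul, smul_eq_mul, mul_comm G, coeff_mul, coeff_mul, coeff_mul,
        Finset.mul_sum, ← Finset.sum_add_distrib]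
      refine Finset.sum_congr rfl fun p hp => ?_
      change _ = coeff p.1 F * ((degree p.2 : ℚ) * coeff p.2 G) +
        ((degree p.1 : ℚ) * coeff p.1 F) * coeff p.2 G
      rw [← Finset.HasAntidiagonal.mem_antidiagonal.1 hp, degree_add]
      push_cast; ring)

theorem coeff_euler (F : MvPowerSeries Var ℚ) (e : Mon) :
    coeff e (euler F) = (degree e : ℚ) * coeff e F := rfl

theorem euler_mem_highDegree {n : ℕ} {F : MvPowerSeries Var ℚ} (hF : F ∈ highDegree n) :
    euler F ∈ highDegree n := fun e he => by rw [coeff_euler, hF e he, mul_zero]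

/-- `∑_{v, k ≥ 1} x_v^k / k`. -/
def logGeneric : MvPowerSeries Var ℚ :=
  fun e => if e.support.card = 1 then (e.sum fun _ k => (k : ℚ))⁻¹ else 0

theorem coeff_logGeneric_single (v : Var) {k : ℕ} (hk : k ≠ 0) :
    coeff (Finsupp.single v k) logGeneric = (k : ℚ)⁻¹ := by
  change (if _ then _ else _) = _
  rw [if_pos (by rw [Finsupp.support_single _ hk, Finset.card_singleton])]
  simp

theorem coeff_logGeneric_of_ne (e : Mon) (h : ∀ v k, k ≠ 0 → e ≠ Finsupp.single v k) :
    coeff e logGeneric = 0 := by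
  refine if_neg fun hc => ?_
  obtain ⟨v, k, hk, he⟩ := Finsupp.card_support_eq_one'.1 hc
  exact h v k hk he

/-- The complete homogeneous function `H_b` with rational coefficients. -/
def completeHomRat (b : ℕ) : MvPowerSeries Var ℚ := fun e => if degree e = b then 1 else 0

theorem coeff_completeHomRat (b : ℕ) (e : Mon) :
    coeff e (completeHomRat b) = if degree e = b then 1 else 0 := rfl

/-- `H_1 + ⋯ + H_d`. -/
def completeHomSum (d : ℕ) : MvPowerSeries Var ℚ := ∑ b ∈ Finset.Icc 1 d, completeHomRat b

theorem coeff_completeHomSum (d : ℕ) (e : Mon) :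
    coeff e (completeHomSum d) = if degree e ∈ Finset.Icc 1 d then 1 else 0 := by
  simp only [completeHomSum, map_sum, coeff_completeHomRat, Finset.sum_ite_eq]

theorem coeff_one_add_completeHomSum (d : ℕ) (e : Mon) :
    coeff e (1 + completeHomSum d) = if degree e ≤ d then 1 else 0 := by
  classical
  rw [map_add, coeff_completeHomSum, coeff_one]
  simp only [Finset.mem_Icc, ← degree_eq_zero_iff]
  split_ifs <;> first | omega | norm_num

/-- This is `E(H) = H · E(log H)` for the Euler derivation `E`. Each power `x_v^k` dividing the
monomial contributes `k · deg v / k = deg v`, and there are `e v` such `k` for each `v`. Below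
degree `d` the truncation of `H` is invisible. -/
theorem coeff_mul_euler_logGeneric {d : ℕ} {e : Mon} (he : degree e ≤ d) :
    coeff e ((1 + completeHomSum d) * euler logGeneric) = (degree e : ℚ) := by
  classical
  rw [coeff_mul]
  have h1 : ∀ p ∈ Finset.HasAntidiagonal.antidiagonal e,
      coeff p.1 (1 + completeHomSum d) * coeff p.2 (euler logGeneric) =
        degree p.2 * coeff p.2 logGeneric := by
    intro p hp
    rw [← Finset.HasAntidiagonal.mem_antidiagonal.1 hp, degree_add] at he
    rw [coeff_one_add_completeHomSum, if_pos (by omega), one_mul, coeff_euler]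
  rw [Finset.sum_congr rfl h1]
  have hle : ∀ x ∈ e.support.sigma fun v => Finset.Icc 1 (e v), Finsupp.single x.1 x.2 ≤ e := by
    intro x hx
    rw [Finset.mem_sigma, Finset.mem_Icc] at hx
    exact Finsupp.single_le_iff.2 hx.2.2
  have h2 : (degree e : ℚ) = ∑ x ∈ e.support.sigma fun v => Finset.Icc 1 (e v), ((x.1.1 : ℕ) : ℚ) := by
    rw [Finset.sum_sigma]
    simp [degree, Finsupp.sum]
  rw [h2]
  symm
  -- Only splittings whose second factor is a pure power `x_v^k` with `1 ≤ k ≤ e v` can contribute.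
  refine Finset.sum_of_injOn (fun x => (e - Finsupp.single x.1 x.2, Finsupp.single x.1 x.2))
    ?_ ?_ ?_ ?_
  · rintro ⟨v, k⟩ hx ⟨w, l⟩ _ h
    have h3 := (Finsupp.single_eq_single_iff _ _ _ _).1 (Prod.ext_iff.1 h).2
    simp only [Finset.coe_sigma, Set.mem_sigma_iff, Finset.coe_Icc, Set.mem_Icc] at hx
    rcases h3 with ⟨rfl, rfl⟩ | h3
    · rfl
    · exact absurd h3.1 (Nat.one_le_iff_ne_zero.1 hx.2.1)
  · intro x hx
    rw [Finset.mem_coe, Finset.HasAntidiagonal.mem_antidiagonal]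
    exact tsub_add_cancel_of_le (hle x hx)
  · intro p hp hn
    rw [coeff_logGeneric_of_ne, mul_zero]
    intro v k hk hv
    rw [Finset.HasAntidiagonal.mem_antidiagonal] at hp
    have hk' : k ≤ e v := by
      rw [← hp, hv]; simp
    refine hn ⟨⟨v, k⟩, ?_, ?_⟩
    · simp only [Finset.coe_sigma, Set.mem_sigma_iff, Finset.coe_Icc, Set.mem_Icc,
        Finset.mem_coe, Finsupp.mem_support_iff]
      omega
    · change (e - Finsupp.single v k, Finsupp.single v k) = p
      rw [← hp, ← hv, add_tsub_cancel_right]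
  · rintro ⟨v, k⟩ hx
    rw [Finset.mem_sigma, Finset.mem_Icc] at hx
    have hk : k ≠ 0 := Nat.one_le_iff_ne_zero.1 hx.2.1
    have hk' : (k : ℚ) ≠ 0 := Nat.cast_ne_zero.2 hk
    simp only [coeff_logGeneric_single v hk, degree_single]
    push_cast
    field_simp

/-- The logarithm `∑_{r ≥ 1} (-1)^{r-1}/r G^r` of `1 + G`, truncated after `r = d`. -/
def truncLog (d : ℕ) (G : MvPowerSeries Var ℚ) : MvPowerSeries Var ℚ :=
  ∑ r ∈ Finset.range d, ((-1 : ℚ) ^ r / ((r + 1 : ℕ) : ℚ)) • G ^ (r + 1)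

/-- The derivation sends `G^(r+1)/(r+1)` to `G^r · E(G)`, so a finite geometric series in `-G`
appears and telescopes. -/
theorem mul_euler_truncLog (d : ℕ) (G : MvPowerSeries Var ℚ) :
    (1 + G) * euler (truncLog d G) = (1 - (-G) ^ d) * euler G := by
  have h : euler (truncLog d G) = (∑ r ∈ Finset.range d, (-G) ^ r) * euler G := by
    rw [truncLog, map_sum, Finset.sum_mul]
    refine Finset.sum_congr rfl fun r _ => ?_
    have hr : ((r + 1 : ℕ) : ℚ) ≠ 0 := Nat.cast_ne_zero.2 r.succ_ne_zero
    rw [Derivation.map_smul, Derivation.leibniz_pow, Nat.add_sub_cancel, ← Nat.cast_smul_eq_nsmul ℚ,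
      smul_smul, div_mul_cancel₀ _ hr, smul_eq_mul, neg_pow G, ← smul_mul_assoc]
    congr 1
    rcases neg_one_pow_eq_or ℚ r with h | h <;> rcases Nat.even_or_odd r with h' | h' <;>
      simp [h'.neg_one_pow]
  rw [h, ← mul_assoc, ← mul_neg_geom_sum, sub_neg_eq_add]

/-- Both logarithms solve `(1 + G) · E(X) = E(G)` up to degree `d`: the error `(-G)^d · E(G)` starts
in degree `d + 1`, as `G` has no constant term. Then `1 + G` is cancelled as a unit, and `E` by
dividing by the nonzero degree. -/
theorem coeff_truncLog_completeHomSum {d : ℕ} {e : Mon} (he : degree e ≤ d) (h0 : e ≠ 0) :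
    coeff e (truncLog d (completeHomSum d)) = coeff e logGeneric := by
  have hG : completeHomSum d ∈ highDegree 1 := by
    intro e he
    rw [coeff_completeHomSum, if_neg (by rw [Finset.mem_Icc]; omega)]
  have hprod : (1 + completeHomSum d) *
      (euler (truncLog d (completeHomSum d)) - euler logGeneric) ∈ highDegree (d + 1) := by
    have h1 : (1 + completeHomSum d) *
        (euler (truncLog d (completeHomSum d)) - euler logGeneric) =
        (euler (completeHomSum d) - (1 + completeHomSum d) * euler logGeneric) -
          (-completeHomSum d) ^ d * euler (completeHomSum d) := by
      rw [mul_sub, mul_euler_truncLog]; ring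
    rw [h1]
    refine sub_mem (fun e he => ?_) (mul_mem_highDegree
      (pow_mem_highDegree (neg_mem hG) d) (euler_mem_highDegree hG))
    rw [map_sub, coeff_mul_euler_logGeneric (by omega), coeff_euler, coeff_completeHomSum]
    rcases Nat.eq_zero_or_pos (degree e) with h | h
    · simp [h]
    · rw [if_pos (by rw [Finset.mem_Icc]; omega), mul_one, sub_self]
  have hunit : constantCoeff (1 + completeHomSum d) ≠ 0 := by
    rw [← coeff_zero_eq_constantCoeff_apply, coeff_one_add_completeHomSum]
    simp
  have h2 := Ideal.mul_mem_left _ (1 + completeHomSum d)⁻¹ hprod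
  rw [← mul_assoc, MvPowerSeries.inv_mul_cancel _ hunit, one_mul] at h2
  have h3 := h2 e (by omega)
  rw [map_sub, coeff_euler, coeff_euler, ← mul_sub] at h3
  have h4 : (degree e : ℚ) ≠ 0 := by
    rw [Nat.cast_ne_zero, Ne, degree_eq_zero_iff]; exact h0
  exact sub_eq_zero.1 ((mul_eq_zero.1 h3).resolve_left h4)

end Polysymmetric

end

/-! ### Triangularity and invertibility of the arrangement matrix. -/

noncomputable section

namespace Polysymmetric

/-- The row equations bound every entry. Finiteness matters because `Nat.card` of an infinite type
is `0`. -/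
theorem finite_arrangement (τ l : Multiset (ℕ × ℕ)) (hl : ∀ p ∈ l, 0 < p.2) :
    Finite (Arrangement τ l) := by
  classical
  have hle : ∀ (A : Arrangement τ l) i j, A.1 i j < (i : ℕ × ℕ).2 + 1 := by
    intro A i j
    rw [Nat.lt_succ_iff, ← congrFun A.2.1 i]
    exact le_trans (Nat.le_mul_of_pos_right _ (hl _ Multiset.coe_mem))
      (Finset.single_le_sum (f := fun j : l => A.1 i j * (j : ℕ × ℕ).2)
        (fun _ _ => Nat.zero_le _) (Finset.mem_univ j))
  refine Finite.of_injective (β := ∀ i : τ, l → Fin ((i : ℕ × ℕ).2 + 1))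
    (fun A i j => ⟨A.1 i j, hle A i j⟩) fun A B h => Subtype.ext (Matrix.ext fun i j => ?_)
  exact Fin.ext_iff.1 (congrFun (congrFun h i) j)

theorem arrangementNumber_self_ne_zero {d : ℕ} (τ : PolyType d) : arrangementNumber τ τ ≠ 0 := by
  classical
  rw [arrangementNumber_eq_card, Nat.cast_ne_zero]
  have := finite_arrangement τ.1 τ.1 fun p hp => (τ.2.1 p hp).2
  have : Nonempty (Arrangement τ.1 τ.1) :=
    ⟨⟨1, Matrix.one_mulVec _, by rw [Matrix.transpose_one, Matrix.one_mulVec]⟩⟩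
  exact Nat.card_pos.ne'

/-- The sum of the squares of the multiplicities of the parts. -/
def sqMult (τ : Multiset (ℕ × ℕ)) : ℕ := (τ.map fun p => p.2 ^ 2).sum

theorem sqMult_eq (τ : Multiset (ℕ × ℕ)) : sqMult τ = ∑ i : τ, (i : ℕ × ℕ).2 ^ 2 := by
  rw [sqMult, ← Multiset.map_univ τ fun p => p.2 ^ 2]; rfl

theorem sum_sq_le_sq_sum {κ : Type} (s : Finset κ) (f : κ → ℕ) :
    ∑ j ∈ s, f j ^ 2 ≤ (∑ j ∈ s, f j) ^ 2 :=
  Finset.sum_sq_le_sq_sum_of_nonneg fun _ _ => Nat.zero_le _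

/-- With `m_i`, `n_j` the multiplicities, `∑ n_j² ≤ ∑_j ∑_i (A_ij n_j)² ≤ ∑_i (∑_j A_ij n_j)² = ∑
m_i²`; the first step uses that no column vanishes. Equality throughout forces `A` to be a
permutation matrix, which matches the parts. -/
theorem Arrangement.eq_or_sqMult_lt {τ l : Multiset (ℕ × ℕ)}
    (hτ : ∀ p ∈ τ, 0 < p.1 ∧ 0 < p.2) (hl : ∀ p ∈ l, 0 < p.1 ∧ 0 < p.2) (A : Arrangement τ l) :
    τ = l ∨ sqMult l < sqMult τ := by
  classical
  obtain ⟨A, hA, hB⟩ := A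
  replace hA : ∀ i : τ, ∑ j : l, A i j * (j : ℕ × ℕ).2 = (i : ℕ × ℕ).2 := congrFun hA
  replace hB : ∀ j : l, ∑ i : τ, A i j * (i : ℕ × ℕ).1 = (j : ℕ × ℕ).1 := congrFun hB
  have hτ' : ∀ i : τ, 0 < (i : ℕ × ℕ).1 ∧ 0 < (i : ℕ × ℕ).2 := fun i => hτ _ Multiset.coe_mem
  have hl' : ∀ j : l, 0 < (j : ℕ × ℕ).1 ∧ 0 < (j : ℕ × ℕ).2 := fun j => hl _ Multiset.coe_mem
  have hcol : ∀ j : l, ∃ i : τ, A i j ≠ 0 := by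
    intro j
    by_contra! h
    have := hB j
    simp only [h, zero_mul, Finset.sum_const_zero] at this
    exact (hl' j).1.ne this
  have hrow : ∀ i : τ, ∃ j : l, A i j ≠ 0 := by
    intro i
    by_contra! h
    have := hA i
    simp only [h, zero_mul, Finset.sum_const_zero] at this
    exact (hτ' i).2.ne this
  choose q hq using hcol
  choose p hp using hrow
  by_contra! hcon
  obtain ⟨hne, hle⟩ := hcon
  rw [sqMult_eq, sqMult_eq] at hle
  have hswap : ∑ i : τ, ∑ j : l, (A i j * (j : ℕ × ℕ).2) ^ 2 =
      ∑ j : l, ∑ i : τ, (A i j * (j : ℕ × ℕ).2) ^ 2 := Finset.sum_comm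
  have h1 : ∀ i ∈ Finset.univ, ∑ j : l, (A i j * (j : ℕ × ℕ).2) ^ 2 ≤ (i : ℕ × ℕ).2 ^ 2 := by
    intro i _
    rw [← hA i]; exact sum_sq_le_sq_sum _ _
  have hqle : ∀ j : l, (j : ℕ × ℕ).2 ^ 2 ≤ (A (q j) j * (j : ℕ × ℕ).2) ^ 2 := fun j =>
    Nat.pow_le_pow_left (Nat.le_mul_of_pos_left _ (Nat.pos_of_ne_zero (hq j))) 2
  have hsing : ∀ j : l, (A (q j) j * (j : ℕ × ℕ).2) ^ 2 ≤
      ∑ i : τ, (A i j * (j : ℕ × ℕ).2) ^ 2 := fun j =>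
    Finset.single_le_sum (f := fun i : τ => (A i j * (j : ℕ × ℕ).2) ^ 2)
      (fun _ _ => Nat.zero_le _) (Finset.mem_univ (q j))
  have h2 : ∀ j ∈ (Finset.univ : Finset l), (j : ℕ × ℕ).2 ^ 2 ≤
      ∑ i : τ, (A i j * (j : ℕ × ℕ).2) ^ 2 := fun j _ => (hqle j).trans (hsing j)
  have s1 := Finset.sum_le_sum h1
  have s2 := Finset.sum_le_sum h2
  -- The assumed reverse inequality closes the chain, so equality holds row by row and column by
  -- column.
  have e1 := (Finset.sum_eq_sum_iff_of_le h1).1 (by omega)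
  have e2 := (Finset.sum_eq_sum_iff_of_le h2).1 (by omega)
  have hcolu : ∀ j i, i ≠ q j → A i j = 0 := by
    intro j i hi
    by_contra h
    have h3 : (A i j * (j : ℕ × ℕ).2) ^ 2 + (A (q j) j * (j : ℕ × ℕ).2) ^ 2 ≤
        ∑ i : τ, (A i j * (j : ℕ × ℕ).2) ^ 2 := by
      rw [← Finset.sum_pair (f := fun i : τ => (A i j * (j : ℕ × ℕ).2) ^ 2) hi]
      exact Finset.sum_le_sum_of_subset (Finset.subset_univ _)
    have h4 : 0 < (A i j * (j : ℕ × ℕ).2) ^ 2 :=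
      pow_pos (Nat.mul_pos (Nat.pos_of_ne_zero h) (hl' j).2) 2
    have := e2 j (Finset.mem_univ _)
    have := hqle j
    omega
  have hone : ∀ j, A (q j) j = 1 := by
    intro j
    have h3 : (A (q j) j * (j : ℕ × ℕ).2) ^ 2 = (j : ℕ × ℕ).2 ^ 2 :=
      le_antisymm ((hsing j).trans (e2 j (Finset.mem_univ _)).ge) (hqle j)
    have h4 := Nat.pow_left_injective (two_ne_zero) h3
    exact Nat.eq_of_mul_eq_mul_right (hl' j).2 (by rw [one_mul]; exact h4)
  -- With two nonzero entries in a row, each summand is less than the row sum, so the sum of squares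
  -- is strictly below the squared sum.
  have hrowu : ∀ i j, j ≠ p i → A i j = 0 := by
    intro i j hj
    by_contra h
    have h3 : A i j * (j : ℕ × ℕ).2 + A i (p i) * (p i : ℕ × ℕ).2 ≤ (i : ℕ × ℕ).2 := by
      rw [← hA i, ← Finset.sum_pair (f := fun j : l => A i j * (j : ℕ × ℕ).2) hj]
      exact Finset.sum_le_sum_of_subset (Finset.subset_univ _)
    have h4 : ∑ j : l, (A i j * (j : ℕ × ℕ).2) ^ 2 < (i : ℕ × ℕ).2 ^ 2 := by
      have h5 : ∀ k ∈ (Finset.univ : Finset l),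
          (A i k * (k : ℕ × ℕ).2) ^ 2 ≤ A i k * (k : ℕ × ℕ).2 * (i : ℕ × ℕ).2 := by
        intro k _
        rw [sq]
        refine Nat.mul_le_mul_left _ ?_
        rw [← hA i]
        exact Finset.single_le_sum (f := fun j : l => A i j * (j : ℕ × ℕ).2)
          (fun _ _ => Nat.zero_le _) (Finset.mem_univ k)
      have h6 : (A i j * (j : ℕ × ℕ).2) ^ 2 < A i j * (j : ℕ × ℕ).2 * (i : ℕ × ℕ).2 := by
        rw [sq]
        refine Nat.mul_lt_mul_of_pos_left ?_ (Nat.mul_pos (Nat.pos_of_ne_zero h) (hl' j).2)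
        have := Nat.mul_pos (Nat.pos_of_ne_zero (hp i)) (hl' (p i)).2
        omega
      refine lt_of_lt_of_eq (Finset.sum_lt_sum h5 ⟨j, Finset.mem_univ _, h6⟩) ?_
      rw [← Finset.sum_mul, hA i, sq]
    exact h4.ne (e1 i (Finset.mem_univ _))
  have hpq : ∀ j, p (q j) = j := by
    intro j
    by_contra h
    exact hq j (hrowu (q j) j (Ne.symm h))
  have hqp : ∀ i, q (p i) = i := by
    intro i
    by_contra h
    exact hp i (hcolu (p i) i (Ne.symm h))
  have hval : ∀ j, (q j : ℕ × ℕ) = (j : ℕ × ℕ) := by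
    intro j
    refine Prod.ext ?_ ?_
    · rw [← hB j, Finset.sum_eq_single (q j) (fun i _ hi => by rw [hcolu j i hi, zero_mul])
        (fun h => absurd (Finset.mem_univ _) h), hone, one_mul]
    · rw [← hA (q j), Finset.sum_eq_single j
        (fun k _ hk => by rw [hrowu (q j) k (by rw [hpq]; exact hk), zero_mul])
        (fun h => absurd (Finset.mem_univ _) h), hone, one_mul]
  refine hne ?_
  rw [← Multiset.map_univ_coe τ, ← Multiset.map_univ_coe l]
  let φ : l ≃ τ := ⟨q, p, hpq, hqp⟩
  have h7 : (Finset.univ : Finset τ).val = (Finset.univ : Finset l).val.map φ := by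
    rw [← Finset.map_univ_equiv φ]; rfl
  rw [h7, Multiset.map_map]
  exact Multiset.map_congr rfl fun j _ => hval j

/-- By induction on `sqMult`, a kernel vector vanishes: row `τ` involves only the entry at `τ` and
entries of smaller `sqMult`. -/
theorem isUnit_arrangementMatrix (d : ℕ) : IsUnit (arrangementMatrix d) := by
  classical
  rw [← Matrix.mulVec_injective_iff_isUnit]
  refine (injective_iff_map_eq_zero (Matrix.mulVecLin (arrangementMatrix d))).2 fun v hv => ?_
  have key : ∀ n, ∀ τ : PolyType d, sqMult τ.1 = n → v τ = 0 := by
    intro n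
    induction n using Nat.strong_induction_on with
    | _ n ih =>
      intro τ hτ
      have h := congrFun hv τ
      rw [Matrix.mulVecLin_apply, Matrix.mulVec, dotProduct, Finset.sum_eq_single τ] at h
      · exact (mul_eq_zero.1 h).resolve_left
          (Int.cast_ne_zero.2 (arrangementNumber_self_ne_zero τ))
      · intro l _ hl
        rcases isEmpty_or_nonempty (Arrangement τ.1 l.1) with h1 | ⟨⟨A⟩⟩
        · have : arrangementNumber τ l = 0 := by rw [arrangementNumber_eq_card]; simp
          simp [arrangementMatrix, this]
        · rcases A.eq_or_sqMult_lt τ.2.1 l.2.1 with h2 | h2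
          · exact absurd (Subtype.ext h2.symm) hl
          · rw [ih _ (hτ ▸ h2) l rfl, mul_zero]
      · exact fun h => absurd (Finset.mem_univ _) h
  exact funext fun τ => key _ τ rfl

end Polysymmetric

end

/-! ### Pure types and powers of the complete homogeneous sum. -/

noncomputable section

namespace Polysymmetric

open MvPowerSeries

theorem map_completeHom (b : ℕ) :
    MvPowerSeries.map (Int.castRingHom ℚ) (completeHom b) = completeHomRat b := by
  ext e
  rw [coeff_map, coeff_completeHomRat]
  change Int.castRingHom ℚ (if degree e = b then 1 else 0) = _
  split_ifs <;> simp

theorem IsPure.eq_map {m : ℕ} {l : Multiset (ℕ × ℕ)} (h : IsPure m l) :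
    (l.map Prod.fst).map (fun b => (b, m)) = l := by
  rw [Multiset.map_map]
  conv_rhs => rw [← Multiset.map_id l]
  exact Multiset.map_congr rfl fun p hp => Prod.ext rfl (h p hp).symm

/-- The Adams operation is a ring homomorphism, so a common multiplicity factors out of the product.
-/
theorem IsPure.completeHomType_eq {m : ℕ} (hm : m ≠ 0) {l : Multiset (ℕ × ℕ)} (h : IsPure m l) :
    completeHomType l = expand m hm ((l.map Prod.fst).map completeHom).prod := by
  rw [completeHomType, map_multiset_prod, Multiset.map_map, Multiset.map_map]
  congr 1
  refine Multiset.map_congr rfl fun p hp => ?_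
  rw [h p hp, Function.comp_apply, Function.comp_apply, MvPowerSeries.expand,
    MvPowerSeries.substAlgHom_apply]
  rfl

theorem IsPure.coeff_smul_completeHomType {m : ℕ} (hm : m ≠ 0) {l : Multiset (ℕ × ℕ)}
    (h : IsPure m l) (g : Mon) : ((coeff (m • g) (completeHomType l) : ℤ) : ℚ) =
      coeff g ((l.map Prod.fst).map completeHomRat).prod := by
  rw [h.completeHomType_eq hm, coeff_expand_smul, ← eq_intCast (Int.castRingHom ℚ), ← coeff_map,
    map_multiset_prod, Multiset.map_map _ completeHom]
  simp only [Function.comp_def, map_completeHom]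

theorem IsPure.coeff_completeHomType_eq_zero {m : ℕ} (hm : m ≠ 0) {l : Multiset (ℕ × ℕ)}
    (h : IsPure m l) {e : Mon} (he : ∀ g : Mon, m • g ≠ e) : coeff e (completeHomType l) = 0 := by
  have : ∃ v, ¬ m ∣ e v := by
    by_contra! hc
    refine he (e.mapRange (fun n => n / m) (Nat.zero_div m)) ?_
    ext v
    simp [Nat.mul_div_cancel' (hc v)]
  obtain ⟨v, hv⟩ := this
  rw [h.completeHomType_eq hm, coeff_expand_of_not_dvd m hm _ hv]

theorem coeff_prod_completeHomRat_of_ne (s : Multiset ℕ) :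
    ∀ g : Mon, degree g ≠ s.sum → coeff g (s.map completeHomRat).prod = 0 := by
  classical
  induction s using Multiset.induction_on with
  | empty =>
    intro g hg
    rw [Multiset.map_zero, Multiset.prod_zero, coeff_one, if_neg]
    rintro rfl
    exact hg degree_zero
  | cons b s ih =>
    intro g hg
    rw [Multiset.map_cons, Multiset.prod_cons, coeff_mul]
    refine Finset.sum_eq_zero fun p hp => ?_
    rw [← Finset.HasAntidiagonal.mem_antidiagonal.1 hp, degree_add, Multiset.sum_cons] at hg
    rw [coeff_completeHomRat]
    split_ifs with h
    · rw [ih p.2 (by omega), mul_zero]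
    · rw [zero_mul]

/-- The coefficient `(-1)^{r-1}/r · r!/∏ c_b!` of `∏_{b ∈ s} H_b` in `log (1 + ∑ H_b)`, where `s`
has `r` elements and contains `b` with multiplicity `c_b`. -/
def logWeight (s : Multiset ℕ) : ℚ :=
  (-1 : ℚ) ^ (s.card - 1) / (s.card : ℚ) * (s.countPerms : ℚ)

variable {d : ℕ}

theorem IsPure.sum_map_fst {m : ℕ} {τ : PolyType d} (h : IsPure m τ.1) :
    m * (τ.1.map Prod.fst).sum = d := by
  conv_rhs => rw [← τ.2.2]
  rw [← Multiset.sum_map_mul_left]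
  congr 1
  exact Multiset.map_congr rfl fun p hp => by rw [h p hp, mul_comm]

theorem PolyType.pos_of_mem_map_fst {τ : PolyType d} :
    ∀ b ∈ τ.1.map Prod.fst, 0 < b := by
  intro b hb
  obtain ⟨p, hp, rfl⟩ := Multiset.mem_map.1 hb
  exact (τ.2.1 p hp).1

theorem PolyType.exists_mem (hd : 0 < d) (τ : PolyType d) : ∃ p, p ∈ τ.1 := by
  refine Multiset.exists_mem_of_ne_zero fun h => ?_
  have := τ.2.2
  rw [h] at this
  exact hd.ne this

theorem card_le_sum {s : Multiset ℕ} (hs : ∀ b ∈ s, 0 < b) : s.card ≤ s.sum := by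
  simpa using Multiset.card_nsmul_le_sum (a := 1) hs

/-- The multinomial theorem expands the power over multisets of `r` elements of `[1, d]`. Attaching
the multiplicity `m` to each element identifies those of sum `d / m` with the `m`-pure types having
`r` parts. -/
theorem sum_pure_eq_coeff_pow {m : ℕ} (hm : 0 < m) {g : Mon} (hg : m * degree g = d) (r : ℕ)
    [DecidablePred fun τ : PolyType d => IsPure m τ.1 ∧ τ.1.card = r] :
    ∑ τ : PolyType d with IsPure m τ.1 ∧ τ.1.card = r,
      ((τ.1.map Prod.fst).countPerms : ℚ) *
        coeff g ((τ.1.map Prod.fst).map completeHomRat).prod =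
      coeff g (completeHomSum d ^ r) := by
  classical
  let F : Multiset ℕ → ℚ := fun s => (s.countPerms : ℚ) * coeff g (s.map completeHomRat).prod
  have h1 : coeff g (completeHomSum d ^ r) = ∑ k ∈ (Finset.Icc 1 d).sym r, F k.1 := by
    rw [completeHomSum, Finset.sum_pow, map_sum]
    refine Finset.sum_congr rfl fun k _ => ?_
    rw [← nsmul_eq_mul, map_nsmul, nsmul_eq_mul]
  rw [h1, ← Finset.sum_image (f := F) (g := fun τ : PolyType d => τ.1.map Prod.fst),
    ← Finset.sum_image (f := F) (g := fun k : Sym ℕ r => k.1)]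
  · refine Finset.sum_subset ?_ ?_
    · intro s hs
      obtain ⟨τ, hτ, rfl⟩ := Finset.mem_image.1 hs
      rw [Finset.mem_filter] at hτ
      refine Finset.mem_image.2 ⟨⟨τ.1.map Prod.fst, by rw [Multiset.card_map, hτ.2.2]⟩, ?_, rfl⟩
      refine Finset.mem_sym_iff.2 fun b hb => ?_
      refine Finset.mem_Icc.2 ⟨PolyType.pos_of_mem_map_fst b hb, ?_⟩
      refine (Multiset.single_le_sum (fun _ _ => Nat.zero_le _) b hb).trans ?_
      conv_rhs => rw [← hτ.2.1.sum_map_fst]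
      exact Nat.le_mul_of_pos_left _ hm
    -- A multiset that comes from no type has the wrong sum, so its product has no term at `g`.
    · intro s hs hn
      obtain ⟨k, hk, rfl⟩ := Finset.mem_image.1 hs
      rw [Finset.mem_sym_iff] at hk
      refine mul_eq_zero_of_right _ (coeff_prod_completeHomRat_of_ne _ g fun hsum => hn ?_)
      refine Finset.mem_image.2 ⟨⟨k.1.map fun b => (b, m), ?_, ?_⟩, ?_, ?_⟩
      · intro p hp
        obtain ⟨b, hb, rfl⟩ := Multiset.mem_map.1 hp
        exact ⟨(Finset.mem_Icc.1 (hk b hb)).1, hm⟩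
      · rw [Multiset.map_map, ← hg, hsum]
        change (k.1.map fun b => b * m).sum = m * k.1.sum
        rw [Multiset.sum_map_mul_right, Multiset.map_id', mul_comm]
      · refine Finset.mem_filter.2 ⟨Finset.mem_univ _, ?_, ?_⟩
        · intro p hp
          obtain ⟨b, hb, rfl⟩ := Multiset.mem_map.1 hp
          rfl
        · rw [Multiset.card_map]; exact k.2
      · simp
  · exact fun k _ k' _ h => Subtype.ext h
  · intro τ hτ τ' hτ' h
    rw [Finset.mem_coe, Finset.mem_filter] at hτ hτ'
    refine Subtype.ext ?_
    rw [← hτ.2.1.eq_map, ← hτ'.2.1.eq_map]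
    exact congrArg _ h

theorem sum_pure_eq_coeff_logGeneric (hd : 0 < d) {m : ℕ} (hm : 0 < m) {g : Mon}
    (hg : m * degree g = d) [DecidablePred fun τ : PolyType d => IsPure m τ.1] :
    ∑ τ : PolyType d with IsPure m τ.1, logWeight (τ.1.map Prod.fst) *
        coeff g ((τ.1.map Prod.fst).map completeHomRat).prod = coeff g logGeneric := by
  classical
  have hgd : degree g ≤ d := by rw [← hg]; exact Nat.le_mul_of_pos_left _ hm
  have hg0 : g ≠ 0 := by
    rintro rfl
    rw [degree_zero, mul_zero] at hg
    exact hd.ne hg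
  rw [← coeff_truncLog_completeHomSum hgd hg0, truncLog, map_sum,
    -- The shift by one matches `truncLog`, whose index `r` carries the power `r + 1`; a type of
    -- degree `d` has between `1` and `d` parts.
    ← Finset.sum_fiberwise_of_maps_to (t := Finset.range d) (g := fun τ => τ.1.card - 1)]
  · refine Finset.sum_congr rfl fun r _ => ?_
    rw [map_smul, ← sum_pure_eq_coeff_pow hm hg (r + 1), Finset.smul_sum, Finset.filter_filter]
    have : (Finset.univ.filter fun τ : PolyType d => IsPure m τ.1 ∧ τ.1.card - 1 = r) =
        Finset.univ.filter fun τ : PolyType d => IsPure m τ.1 ∧ τ.1.card = r + 1 := by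
      refine Finset.filter_congr fun τ _ => and_congr_right fun _ => ?_
      obtain ⟨p, hp⟩ := τ.exists_mem hd
      have := Multiset.card_pos_iff_exists_mem.2 ⟨p, hp⟩
      omega
    rw [this]
    refine Finset.sum_congr rfl fun τ hτ => ?_
    have hr := (Finset.mem_filter.1 hτ).2.2
    rw [logWeight, Multiset.card_map, hr, Nat.add_sub_cancel, smul_eq_mul, mul_assoc]
  · intro τ hτ
    have h1 := (Finset.mem_filter.1 hτ).2.sum_map_fst
    have h2 := card_le_sum (PolyType.pos_of_mem_map_fst (τ := τ))
    rw [Multiset.card_map] at h2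
    have h3 := h2.trans (Nat.le_mul_of_pos_left _ hm)
    rw [h1] at h3
    exact Finset.mem_range.2 (by omega)

/-! ### Möbius inversion and the column of the inverse. -/

/-- The coefficients of the expansion of `M_{(d)}` in the `H_τ`. -/
def topColumn (τ : PolyType d) : ℚ :=
  open Classical in ∑ m ∈ d.divisors, if IsPure m τ.1 then
    ((ArithmeticFunction.moebius m : ℤ) : ℚ) / (m : ℚ) * logWeight (τ.1.map Prod.fst) else 0

theorem arrangementNumber_monType {τ : PolyType d} {e : Mon} (he : monType e = τ.1)
    (l : PolyType d) : arrangementNumber τ l = coeff e (completeHomType l.1) := by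
  have hl : ∀ p ∈ l.1, 0 < p.2 := fun p hp => (l.2.1 p hp).2
  rw [arrangementNumber_eq_card, coeff_completeHomType _ hl, card_factorization _ _ hl, he]

theorem sum_moebius_divisors_cast (n : ℕ) :
    ∑ m ∈ n.divisors, ((ArithmeticFunction.moebius m : ℤ) : ℚ) = if n = 1 then 1 else 0 := by
  have h := congrArg (fun f : ArithmeticFunction ℤ => f n) ArithmeticFunction.moebius_mul_coe_zeta
  simp only [ArithmeticFunction.coe_mul_zeta_apply, ArithmeticFunction.one_apply] at h
  rw [← Int.cast_sum, h]
  split_ifs <;> simp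

/-- Row `τ` is the coefficient of `∑_m μ(m)/m ψ_m(L)` at a monomial of type `τ`. It vanishes unless
the monomial is a power `x_v^n`, where it equals `(1/n) ∑_{m ∣ n} μ(m)`, that is, `1` if `n = 1` and
`0` otherwise. -/
theorem mulVec_topColumn (hd : 0 < d) :
    (arrangementMatrix d).mulVec topColumn = Pi.single (topType d hd) 1 := by
  classical
  funext τ
  obtain ⟨e, he⟩ := exists_monType τ
  have hde : degree e = d := by rw [degree_eq_sum_monType, he, τ.2.2]
  have h1 : (arrangementMatrix d).mulVec topColumn τ = ∑ m ∈ d.divisors,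
      ((ArithmeticFunction.moebius m : ℤ) : ℚ) / (m : ℚ) *
        ∑ l : PolyType d with IsPure m l.1, logWeight (l.1.map Prod.fst) *
          ((coeff e (completeHomType l.1) : ℤ) : ℚ) := by
    simp only [Matrix.mulVec, dotProduct, topColumn, Finset.mul_sum]
    rw [Finset.sum_comm]
    refine Finset.sum_congr rfl fun m _ => ?_
    rw [Finset.sum_filter]
    refine Finset.sum_congr rfl fun l _ => ?_
    rw [← arrangementNumber_monType he l]
    simp only [arrangementMatrix, Matrix.of_apply]
    split_ifs <;> ring
  have hsmul : ∀ m ∈ d.divisors, ∀ g : Mon, m • g = e →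
      ∑ l : PolyType d with IsPure m l.1, logWeight (l.1.map Prod.fst) *
          ((coeff e (completeHomType l.1) : ℤ) : ℚ) = coeff g logGeneric := by
    rintro m hm g rfl
    have hm0 := Nat.pos_of_mem_divisors hm
    rw [← sum_pure_eq_coeff_logGeneric hd hm0 (by rw [← degree_nsmul, hde])]
    refine Finset.sum_congr rfl fun l hl => ?_
    rw [(Finset.mem_filter.1 hl).2.coeff_smul_completeHomType hm0.ne']
  have hzero : ∀ m ∈ d.divisors, (∀ g : Mon, m • g ≠ e) →
      ∑ l : PolyType d with IsPure m l.1, logWeight (l.1.map Prod.fst) *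
          ((coeff e (completeHomType l.1) : ℤ) : ℚ) = 0 := by
    intro m hm hg
    refine Finset.sum_eq_zero fun l hl => ?_
    rw [(Finset.mem_filter.1 hl).2.coeff_completeHomType_eq_zero
      (Nat.pos_of_mem_divisors hm).ne' hg, Int.cast_zero, mul_zero]
  rw [h1]
  by_cases hs : ∃ v n, n ≠ 0 ∧ e = Finsupp.single v n
  · obtain ⟨v, n, hn, rfl⟩ := hs
    rw [degree_single] at hde
    have hnd : n ∣ d := ⟨_, hde.symm⟩
    have hn' : (n : ℚ) ≠ 0 := Nat.cast_ne_zero.2 hn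
    -- If `m ∣ n`, the coefficient of `ψ_m(L)` at `x_v^n` is `m/n`, and the factor `m` cancels.
    have h2 : ∀ m ∈ d.divisors, ((ArithmeticFunction.moebius m : ℤ) : ℚ) / (m : ℚ) *
        ∑ l : PolyType d with IsPure m l.1, logWeight (l.1.map Prod.fst) *
          ((coeff (Finsupp.single v n) (completeHomType l.1) : ℤ) : ℚ) =
        if m ∣ n then ((ArithmeticFunction.moebius m : ℤ) : ℚ) / n else 0 := by
      intro m hm
      have hm0 : (m : ℚ) ≠ 0 := Nat.cast_ne_zero.2 (Nat.pos_of_mem_divisors hm).ne'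
      split_ifs with hmn
      · obtain ⟨k, rfl⟩ := hmn
        have hk : k ≠ 0 := right_ne_zero_of_mul hn
        have hk' : (k : ℚ) ≠ 0 := Nat.cast_ne_zero.2 hk
        rw [hsmul m hm (Finsupp.single v k) (by rw [Finsupp.smul_single, smul_eq_mul]),
          coeff_logGeneric_single v hk]
        push_cast
        field_simp
      · rw [hzero m hm, mul_zero]
        intro g hg
        refine hmn ⟨g v, ?_⟩
        have := DFunLike.congr_fun hg v
        rw [Finsupp.smul_apply, Finsupp.single_eq_same, smul_eq_mul] at this
        exact this.symm
    rw [Finset.sum_congr rfl h2, ← Finset.sum_filter]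
    have h3 : d.divisors.filter (fun m => m ∣ n) = n.divisors := by
      ext m
      simp only [Finset.mem_filter, Nat.mem_divisors]
      exact ⟨fun h => ⟨h.2, hn⟩, fun h => ⟨⟨h.1.trans hnd, hd.ne'⟩, h.1⟩⟩
    rw [h3, ← Finset.sum_div, sum_moebius_divisors_cast, Pi.single_apply]
    have h4 : τ = topType d hd ↔ n = 1 := by
      have h5 : monType (Finsupp.single v n) = {((v.1 : ℕ), n)} := by
        rw [monType, Finsupp.support_single _ hn]; simp
      rw [Subtype.ext_iff, ← he, h5, topType, Multiset.singleton_inj, Prod.mk.injEq]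
      refine ⟨fun h => h.2, fun h => ⟨?_, h⟩⟩
      rw [h, one_mul] at hde
      exact hde
    simp only [h4]
    split_ifs with h
    · rw [h]; norm_num
    · rw [zero_div]
  · rw [Finset.sum_eq_zero, Pi.single_apply, if_neg]
    · rintro rfl
      have h2 := congrArg Multiset.card he
      rw [monType, Multiset.card_map, topType, Multiset.card_singleton] at h2
      obtain ⟨v, n, hn, h3⟩ := Finsupp.card_support_eq_one'.1 h2
      exact hs ⟨v, n, hn, h3⟩
    · intro m hm
      refine mul_eq_zero_of_right _ ?_
      by_cases h : ∃ g : Mon, m • g = e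
      · obtain ⟨g, hg⟩ := h
        rw [hsmul m hm g hg]
        refine coeff_logGeneric_of_ne g fun v k hk hgk => hs ⟨v, m * k, ?_, ?_⟩
        · exact mul_ne_zero (Nat.pos_of_mem_divisors hm).ne' hk
        · rw [← hg, hgk, Finsupp.smul_single, smul_eq_mul]
      · exact hzero m hm fun g hg => h ⟨g, hg⟩

theorem inv_arrangementMatrix_topType (hd : 0 < d) (τ : PolyType d) :
    (arrangementMatrix d)⁻¹ τ (topType d hd) = topColumn τ := by
  classical
  have h := congrArg ((arrangementMatrix d)⁻¹.mulVec) (mulVec_topColumn hd)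
  rw [Matrix.mulVec_mulVec, Matrix.nonsing_inv_mul _
    ((Matrix.isUnit_iff_isUnit_det _).1 (isUnit_arrangementMatrix d)), Matrix.one_mulVec,
    Matrix.mulVec_single_one] at h
  exact (congrFun h τ).symm

theorem IsPure.pos {m : ℕ} (hd : 0 < d) {τ : PolyType d} (h : IsPure m τ.1) : 0 < m := by
  obtain ⟨p, hp⟩ := τ.exists_mem hd
  rw [← h p hp]
  exact (τ.2.1 p hp).2

/-- As `d > 0`, the type has a part, which determines `m`; one term of the sum over divisors
survives. -/
theorem IsPure.topColumn_eq {m : ℕ} (hd : 0 < d) {τ : PolyType d} (h : IsPure m τ.1) :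
    topColumn τ = ((ArithmeticFunction.moebius m : ℤ) : ℚ) / (m : ℚ) *
      logWeight (τ.1.map Prod.fst) := by
  classical
  obtain ⟨p, hp⟩ := τ.exists_mem hd
  rw [topColumn, Finset.sum_eq_single m, if_pos h]
  · intro n _ hn
    rw [if_neg fun h' => hn ((h' p hp).symm.trans (h p hp))]
  · intro hn
    exact absurd (Nat.mem_divisors.2 ⟨⟨_, h.sum_map_fst.symm⟩, hd.ne'⟩) hn

/-- `countPerms` is a multinomial coefficient over the values that occur; extending the range to
`[1, d / m]` only adds factors `0! = 1`. -/
theorem IsPure.countPerms_eq {m : ℕ} (hd : 0 < d) {τ : PolyType d} (h : IsPure m τ.1) :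
    ((τ.1.map Prod.fst).countPerms : ℚ) = (Nat.factorial (Multiset.card τ.1) : ℚ) /
      ∏ b ∈ Finset.Icc 1 (d / m), (Nat.factorial (τ.1.count (b, m)) : ℚ) := by
  have hsub : ∀ b ∈ τ.1.map Prod.fst, b ∈ Finset.Icc 1 (d / m) := by
    intro b hb
    refine Finset.mem_Icc.2 ⟨PolyType.pos_of_mem_map_fst b hb, ?_⟩
    rw [Nat.div_eq_of_eq_mul_right (h.pos hd) h.sum_map_fst.symm]
    exact Multiset.single_le_sum (fun _ _ => Nat.zero_le _) b hb
  have hcount : ∀ b, τ.1.count (b, m) = (τ.1.map Prod.fst).count b := by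
    intro b
    conv_lhs => rw [← h.eq_map]
    exact Multiset.count_map_eq_count' _ _ (fun _ _ h => (Prod.ext_iff.1 h).1) b
  have h1 : (τ.1.map Prod.fst).countPerms =
      Nat.multinomial (Finset.Icc 1 (d / m)) fun b => (τ.1.map Prod.fst).count b := by
    refine Finsupp.multinomial_eq_of_support_subset fun b hb => hsub b ?_
    simpa using hb
  have h2 := Nat.multinomial_spec (Finset.Icc 1 (d / m)) fun b => (τ.1.map Prod.fst).count b
  rw [← h1, Multiset.sum_count_eq_card hsub, Multiset.card_map] at h2
  rw [eq_div_iff (Finset.prod_ne_zero_iff.2 fun b _ =>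
    Nat.cast_ne_zero.2 (Nat.factorial_ne_zero _)), ← h2]
  simp only [hcount]
  push_cast
  exact mul_comm _ _

end Polysymmetric

end

theorem mainTheorem5 (d : ℕ) (hd : 0 < d) :
    IsUnit (Polysymmetric.arrangementMatrix d) ∧
    ∀ τ : Polysymmetric.PolyType d,
      (Polysymmetric.IsMixed τ.1 →
        (Polysymmetric.arrangementMatrix d)⁻¹ τ (Polysymmetric.topType d hd) = 0) ∧
      ∀ m : ℕ, Polysymmetric.IsPure m τ.1 →
        (Polysymmetric.arrangementMatrix d)⁻¹ τ (Polysymmetric.topType d hd) =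
          ((ArithmeticFunction.moebius m : ℤ) : ℚ) / (m : ℚ) *
            ((-1 : ℚ) ^ (Multiset.card τ.1 - 1) / (Multiset.card τ.1 : ℚ)) *
            ((Nat.factorial (Multiset.card τ.1) : ℚ) /
              ∏ b ∈ Finset.Icc 1 (d / m), (Nat.factorial (τ.1.count (b, m)) : ℚ)) := by
  refine ⟨Polysymmetric.isUnit_arrangementMatrix d, fun τ => ⟨fun h => ?_, fun m h => ?_⟩⟩
  · rw [Polysymmetric.inv_arrangementMatrix_topType, Polysymmetric.topColumn]
    exact Finset.sum_eq_zero fun m hm => if_neg (h m (Nat.pos_of_mem_divisors hm))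
  · rw [Polysymmetric.inv_arrangementMatrix_topType, h.topColumn_eq hd, Polysymmetric.logWeight,
      h.countPerms_eq hd, Multiset.card_map, mul_assoc]
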